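/- Let $\zeta$ be the standard coordinate on $\mathbb{C}$, and let $\Omega\subset\mathbb{C}$ be a simply connected open set with $0\in\overline{\Omega}$, $0\notin\Omega$, that is star-shaped around $0$: for every $a\in\Omega$ and $t\in(0,1]$, $ta\in\Omega$. Let $p,q$ be holomorphic on $\Omega$ with $p$ nowhere zero on $\Omega$, put $k_0(a,a')=-q(a')/p(a)$, and let $k_\star$ be holomorphic on $\Omega^2$. Set $$[\mathcal{V}_0\varphi](a)=\int_0^a k_0(a,a')\,\varphi(a')\,da',\qquad [\mathcal{V}_\star\varphi](a)=\int_0^a k_\star(a,a')\,\varphi(a')\,da',\qquad \mathcal{V}=\mathcal{V}_0+\mathcal{V}_\star,$$ where the integrals are taken along the straight path from $0$ to $a$. Suppose that there are real constants $\tau>0$, $\gamma>0$ and $\lambda_\Delta$ such that 1. $k_0(a,a)-\tau/a$ is bounded for $a$ in a neighborhood of $0$ in $\Omega$, and for each $\sigma>\tau$ one has $|k_0(a,a')|<\sigma/|a|$ on a neighborhood of $(0,0)$ in $\Omega^2$; 2. there is a constant $C$ with $|k_0(a,a')|\le C\,|a|^{-1}e^{\lambda_\Delta|a-a'|}$ for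 all $a,a'\in\Omega$; 3. there is a constant $C$ with $|k_\star(a,a')|\le C\,|a-a'|^{\gamma}\,|a|^{-1}e^{\lambda_\Delta|a-a'|}$ for all $a,a'\in\Omega$. Fix $b\in\Omega$ and let $f_0(a)=\frac{1}{p(a)}\exp\left(-\int_b^a\frac{q}{p}\,d\zeta\right)$, where the integral is taken along any path in $\Omega$. For $\sigma\in\mathbb{R}$ let $E^{\sigma}(\Omega)$ be the space of holomorphic functions $f$ on $\Omega$ for which there are real constants $\Lambda$ and $C$ with $|f(z)|\le C|z|^{\sigma}e^{\Lambda|z|}$ for all $z\in\Omega$. Then, for every real $\rho>\tau$, the equation $f=\mathcal{V}f$ on $\Omega$ has at most one solution $f$ in the affine space $f_0+E^{\rho-1}(\Omega)$. -/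

import Mathlib

open Set Filter Topology

noncomputable section

namespace HoloVolterra

/-- The standing assumptions on the domain: a simply connected open set that touches but does not
contain the origin, and is star-shaped around the origin (for each of its points `a`, the half-open
segment from `0`, excluded, to `a` stays in the set). -/
structure IsStarDomain (Ω : Set ℂ) : Prop where
  isOpen : IsOpen Ω
  simplyConnected : IsSimplyConnected Ω
  touches_zero : (0 : ℂ) ∈ closure Ω
  zero_notMem : (0 : ℂ) ∉ Ω
  star : ∀ a ∈ Ω, ∀ t : ℝ, 0 < t → t ≤ 1 → (t : ℂ) * a ∈ Ω

/-- The integral operator with kernel `w`, namely `[W φ](a) = ∫_{0}^{a} w(a, a') φ(a') da'`,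
the integral being taken along the straight path `a' = t a`, `t ∈ (0, 1]`. -/
def volterraOp (w : ℂ → ℂ → ℂ) (φ : ℂ → ℂ) (a : ℂ) : ℂ :=
  ∫ t in (0 : ℝ)..1, w a ((t : ℂ) * a) * φ ((t : ℂ) * a) * a

/-- The separable kernel `k₀(a, a') = -q(a') / p(a)`. -/
def sepKernel (p q : ℂ → ℂ) (a a' : ℂ) : ℂ := -(q a' / p a)

/-- The prototype operator `V₀`, with kernel `-q(a') / p(a)`. -/
def protoOp (p q : ℂ → ℂ) : (ℂ → ℂ) → ℂ → ℂ := volterraOp (sepKernel p q)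

/-- The perturbed operator `V = V₀ + V⋆`. -/
def perturbedOp (p q : ℂ → ℂ) (kstar : ℂ → ℂ → ℂ) (φ : ℂ → ℂ) (a : ℂ) : ℂ :=
  protoOp p q φ a + volterraOp kstar φ a

/-- `k₀` has a regular singularity at the origin with constant `τ > 0`: the difference
`k₀(a, a) - τ / a` is bounded near `0` in `Ω`, and for each `σ > τ` the bound
`|k₀(a, a')| < σ / |a|` holds near `(0, 0)` in `Ω²`. -/
structure RegularSingular (Ω : Set ℂ) (k₀ : ℂ → ℂ → ℂ) (τ : ℝ) : Prop where
  pos : 0 < τ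
  diag : ∃ C : ℝ, ∀ᶠ a in 𝓝[Ω] (0 : ℂ), ‖k₀ a a - (τ : ℂ) / a‖ ≤ C
  near : ∀ σ : ℝ, τ < σ →
    ∀ᶠ x in 𝓝[Ω ×ˢ Ω] ((0, 0) : ℂ × ℂ), ‖k₀ x.1 x.2‖ < σ / ‖x.1‖

/-- `|k₀(a, a')| ≲ |a|⁻¹ exp(lam |a - a'|)` over all `a, a' ∈ Ω`. -/
def DiagBound (Ω : Set ℂ) (k₀ : ℂ → ℂ → ℂ) (lam : ℝ) : Prop :=
  ∃ C : ℝ, ∀ a ∈ Ω, ∀ a' ∈ Ω,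
    ‖k₀ a a'‖ ≤ C * (1 / ‖a‖ * Real.exp (lam * ‖a - a'‖))

/-- For a constant `γ > 0`, `|k⋆(a, a')| ≲ (|a - a'| ^ γ / |a|) exp(lam |a - a'|)` over all
`a, a' ∈ Ω`. -/
structure DiagVanishing (Ω : Set ℂ) (kstar : ℂ → ℂ → ℂ) (γ lam : ℝ) : Prop where
  pos : 0 < γ
  bound : ∃ C : ℝ, ∀ a ∈ Ω, ∀ a' ∈ Ω,
    ‖kstar a a'‖ ≤ C * (‖a - a'‖ ^ γ / ‖a‖ * Real.exp (lam * ‖a - a'‖))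

/-- `γ` is a continuously differentiable path in `Ω`. -/
def IsC1PathIn (Ω : Set ℂ) {b a : ℂ} (γ : Path b a) : Prop :=
  ContDiffOn ℝ 1 γ.extend (Icc (0 : ℝ) 1) ∧ ∀ t, γ t ∈ Ω

open Classical in
/-- The integral `∫_b^a g dζ` inside `Ω`, along some continuously differentiable path in `Ω`
from `b` to `a`. When `Ω` is open and simply connected, `a, b ∈ Ω` and `g` is holomorphic on `Ω`,
such a path exists and its choice does not matter. -/
def integralIn (Ω : Set ℂ) (g : ℂ → ℂ) (b a : ℂ) : ℂ :=
  if h : ∃ γ : Path b a, IsC1PathIn Ω γ then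
    curveIntegral (fun z => g z • ContinuousLinearMap.id ℂ ℂ) h.choose
  else 0

/-- The prototype solution `f₀(a) = (1 / p(a)) exp(-∫_b^a (q / p) dζ)`. -/
def protoSolution (Ω : Set ℂ) (p q : ℂ → ℂ) (b a : ℂ) : ℂ :=
  1 / p a * Complex.exp (-integralIn Ω (fun z => q z / p z) b a)

/-- The functions holomorphic on `Ω` with `|f| ≲ |ζ| ^ σ exp(Lam |ζ|)` over `Ω`. A function on `Ω`
is represented by a function on `ℂ` of which only the values on `Ω` matter. -/
def singExp (σ Lam : ℝ) (Ω : Set ℂ) : Set (ℂ → ℂ) :=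
  {f | DifferentiableOn ℂ f Ω ∧
    ∃ C : ℝ, ∀ z ∈ Ω, ‖f z‖ ≤ C * (‖z‖ ^ σ * Real.exp (Lam * ‖z‖))}

/-- The union of the spaces `singExp σ Lam Ω` over all real `Lam`. -/
def singExpAlg (σ : ℝ) (Ω : Set ℂ) : Set (ℂ → ℂ) := ⋃ Lam : ℝ, singExp σ Lam Ω

end HoloVolterra

end

namespace HoloVolterra

/-! In the difference `u = f - g` the term `f₀` cancels, so `u` is holomorphic and `O(|ζ| ^ (ρ -
1))` near `0`. There the total kernel is at most `(σ + ε) / |a|`, where `τ < σ` and `σ + ε < ρ`.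
Since `∫₀¹ t ^ (ρ - 1) dt = 1 / ρ`, each use of `u = V u` shrinks the constant in the bound by `θ =
(σ + ε) / ρ < 1` (`norm_volterraOp_sub_le`). Iterating gives `u = 0` near `0` in `Ω`, and the
identity theorem spreads this to all of `Ω`. Only differences are estimated, so `V f` and `V g` need
not be known to converge separately. -/

/-- Two integrals differ by at most the integral of a dominating function, even when the
integrands are not integrable (both integrals are then zero by convention). -/
theorem norm_integral_sub_integral_le {α E : Type*} [MeasurableSpace α]
    {μ : MeasureTheory.Measure α} [NormedAddCommGroup E] [NormedSpace ℝ E] {F G : α → E}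
    {B : α → ℝ} (hm : MeasureTheory.AEStronglyMeasurable (fun t => F t - G t) μ)
    (hB : MeasureTheory.Integrable B μ) (hle : ∀ᵐ t ∂μ, ‖F t - G t‖ ≤ B t) :
    ‖∫ t, F t ∂μ - ∫ t, G t ∂μ‖ ≤ ∫ t, B t ∂μ := by
  have hd : MeasureTheory.Integrable (fun t => F t - G t) μ := hB.mono' hm hle
  by_cases hG : MeasureTheory.Integrable G μ
  · have hF : MeasureTheory.Integrable F μ :=
      (hd.add hG).congr (Eventually.of_forall fun t => sub_add_cancel (F t) (G t))
    rw [← MeasureTheory.integral_sub hF hG]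
    exact MeasureTheory.norm_integral_le_of_norm_le hB hle
  · have hF : ¬ MeasureTheory.Integrable F μ := fun hF => hG ((hF.sub hd).congr
      (Eventually.of_forall fun t => sub_sub_cancel (F t) (G t)))
    rw [MeasureTheory.integral_undef hF, MeasureTheory.integral_undef hG, sub_zero, norm_zero]
    exact MeasureTheory.integral_nonneg_of_ae (hle.mono fun t ht => (norm_nonneg _).trans ht)

/-- A kernel of size at most `s / |a|` along the segment from `0` to `a` acts on differences of size
`M |ζ| ^ (ρ - 1)` with norm at most `s / ρ`. -/
theorem norm_volterraOp_sub_le {Ω : Set ℂ} (hΩ : IsStarDomain Ω) {w : ℂ → ℂ → ℂ} {f g : ℂ → ℂ}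
    {a : ℂ} (ha : a ∈ Ω) {s M ρ : ℝ} (hs : 0 ≤ s) (hρ : 0 < ρ)
    (hw : ContinuousOn (w a) Ω) (hd : ContinuousOn (f - g) Ω)
    (hwb : ∀ t : ℝ, 0 < t → t ≤ 1 → ‖w a (t * a)‖ ≤ s / ‖a‖)
    (hdb : ∀ t : ℝ, 0 < t → t ≤ 1 → ‖(f - g) (t * a)‖ ≤ M * ‖(t : ℂ) * a‖ ^ (ρ - 1)) :
    ‖volterraOp w f a - volterraOp w g a‖ ≤ s / ρ * (M * ‖a‖ ^ (ρ - 1)) := by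
  have ha0 : 0 < ‖a‖ := norm_pos_iff.2 fun h => hΩ.zero_notMem (h ▸ ha)
  have hint : IntervalIntegrable (fun t : ℝ => s * (M * ‖a‖ ^ (ρ - 1)) * t ^ (ρ - 1))
      MeasureTheory.volume 0 1 :=
    (intervalIntegral.intervalIntegrable_rpow' (by linarith)).const_mul _
  have hval : ∫ t in (0 : ℝ)..1, s * (M * ‖a‖ ^ (ρ - 1)) * t ^ (ρ - 1)
      = s / ρ * (M * ‖a‖ ^ (ρ - 1)) := by
    rw [intervalIntegral.integral_const_mul, integral_rpow (Or.inl (by linarith)),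
      sub_add_cancel, Real.one_rpow, Real.zero_rpow hρ.ne']
    ring
  have hmaps : MapsTo (fun t : ℝ => (t : ℂ) * a) (Ioc 0 1) Ω :=
    fun t ht => hΩ.star a ha t ht.1 ht.2
  have hray : ContinuousOn (fun t : ℝ => (t : ℂ) * a) (Ioc 0 1) := by fun_prop
  rw [← hval]
  unfold volterraOp
  rw [intervalIntegral.integral_of_le zero_le_one, intervalIntegral.integral_of_le zero_le_one,
    intervalIntegral.integral_of_le zero_le_one]
  refine norm_integral_sub_integral_le ?_ ((intervalIntegrable_iff_integrableOn_Ioc_of_le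
    zero_le_one).1 hint) ?_
  · refine ContinuousOn.aestronglyMeasurable ?_ measurableSet_Ioc
    refine (((hw.comp hray hmaps).mul (hd.comp hray hmaps)).mul
      (continuousOn_const (c := a))).congr fun t _ => ?_
    simp only [Function.comp_apply, Pi.sub_apply, Pi.mul_apply]
    ring
  · refine (MeasureTheory.ae_restrict_iff' measurableSet_Ioc).2 (Eventually.of_forall ?_)
    intro t ht
    have h1 := hwb t ht.1 ht.2
    have h2 := hdb t ht.1 ht.2
    rw [norm_mul, Complex.norm_real, Real.norm_of_nonneg ht.1.le,
      Real.mul_rpow ht.1.le ha0.le] at h2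
    calc ‖w a (t * a) * f (t * a) * a - w a (t * a) * g (t * a) * a‖
        = ‖w a (t * a)‖ * ‖(f - g) (t * a)‖ * ‖a‖ := by
          rw [← norm_mul, ← norm_mul, Pi.sub_apply]
          congr 1
          ring
      _ ≤ s / ‖a‖ * (M * (t ^ (ρ - 1) * ‖a‖ ^ (ρ - 1))) * ‖a‖ := by gcongr
      -- The factor `a` from `da' = a dt` cancels the singularity `1 / |a|` of the kernel.
      _ = s * (M * ‖a‖ ^ (ρ - 1)) * t ^ (ρ - 1) := by field_simp

/-- A kernel that vanishes on the diagonal is smaller than `ε / |a|` near `(0, 0)`. -/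
theorem DiagVanishing.exists_near {Ω : Set ℂ} {kstar : ℂ → ℂ → ℂ} {γ lam : ℝ}
    (h : DiagVanishing Ω kstar γ lam) {ε : ℝ} (hε : 0 < ε) :
    ∃ δ > 0, ∀ a ∈ Ω, ∀ a' ∈ Ω, ‖a‖ < δ → ‖a'‖ < δ → ‖kstar a a'‖ ≤ ε / ‖a‖ := by
  obtain ⟨C, hC⟩ := h.bound
  have hc : Continuous fun x : ℂ × ℂ =>
      C * (‖x.1 - x.2‖ ^ γ * Real.exp (lam * ‖x.1 - x.2‖)) := by
    have := h.pos.le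
    exact continuous_const.mul (((continuous_fst.sub continuous_snd).norm.rpow_const
      fun _ => Or.inr this).mul (by fun_prop))
  have h0 : ∀ᶠ x in 𝓝 (0 : ℂ × ℂ), C * (‖x.1 - x.2‖ ^ γ * Real.exp (lam * ‖x.1 - x.2‖)) < ε := by
    refine hc.continuousAt.eventually_lt_const ?_
    -- At the origin the factor `0 ^ γ` is `0`, because `γ ≠ 0`.
    simpa [Real.zero_rpow h.pos.ne'] using hε
  obtain ⟨δ, hδ, hb⟩ := Metric.eventually_nhds_iff.1 h0
  refine ⟨δ, hδ, fun a ha a' ha' hn hn' => (hC a ha a' ha').trans ?_⟩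
  have := hb (y := (a, a')) (by simpa [Prod.norm_def] using ⟨hn, hn'⟩)
  calc C * (‖a - a'‖ ^ γ / ‖a‖ * Real.exp (lam * ‖a - a'‖))
      = C * (‖a - a'‖ ^ γ * Real.exp (lam * ‖a - a'‖)) / ‖a‖ := by ring
    _ ≤ ε / ‖a‖ := by gcongr

/-- A kernel with a regular singularity with constant `τ` is at most `σ / |a|` near `(0, 0)`, for
every `σ > τ`. -/
theorem RegularSingular.exists_near {Ω : Set ℂ} {k₀ : ℂ → ℂ → ℂ} {τ σ : ℝ}
    (h : RegularSingular Ω k₀ τ) (hσ : τ < σ) :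
    ∃ δ > 0, ∀ a ∈ Ω, ∀ a' ∈ Ω, ‖a‖ < δ → ‖a'‖ < δ → ‖k₀ a a'‖ ≤ σ / ‖a‖ := by
  obtain ⟨δ, hδ, hb⟩ := Metric.eventually_nhds_iff.1 (eventually_nhdsWithin_iff.1 (h.near σ hσ))
  refine ⟨δ, hδ, fun a ha a' ha' hn hn' => ?_⟩
  exact (hb (y := (a, a')) (by simpa [Prod.dist_eq] using ⟨hn, hn'⟩) ⟨ha, ha'⟩).le

/-- Differences of functions with the same representative modulo `singExpAlg σ Ω`: they are
holomorphic and dominated by `|ζ| ^ σ` near the origin. -/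
theorem exists_bound_of_sub_mem_singExpAlg {Ω : Set ℂ} {σ : ℝ} {f g h : ℂ → ℂ}
    (hf : f - h ∈ singExpAlg σ Ω) (hg : g - h ∈ singExpAlg σ Ω) :
    DifferentiableOn ℂ (f - g) Ω ∧
      ∃ M : ℝ, ∀ z ∈ Ω, ‖z‖ < 1 → ‖(f - g) z‖ ≤ M * ‖z‖ ^ σ := by
  have key : ∀ u ∈ singExpAlg σ Ω, DifferentiableOn ℂ u Ω ∧
      ∃ M : ℝ, ∀ z ∈ Ω, ‖z‖ < 1 → ‖u z‖ ≤ M * ‖z‖ ^ σ := by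
    intro u hu
    obtain ⟨L, hd, C, hC⟩ := mem_iUnion.1 hu
    -- On the unit disc the exponential is bounded by a constant; `C` and `L` may be negative.
    refine ⟨hd, |C| * Real.exp |L|, fun z hz hz1 => (hC z hz).trans ?_⟩
    have hL : L * ‖z‖ ≤ |L| :=
      (mul_le_mul_of_nonneg_right (le_abs_self L) (norm_nonneg z)).trans
        (mul_le_of_le_one_right (abs_nonneg L) hz1.le)
    calc C * (‖z‖ ^ σ * Real.exp (L * ‖z‖)) ≤ |C| * (‖z‖ ^ σ * Real.exp |L|) := by
          gcongr
          exact le_abs_self C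
      _ = |C| * Real.exp |L| * ‖z‖ ^ σ := by ring
  obtain ⟨hfd, M, hM⟩ := key _ hf
  obtain ⟨hgd, N, hN⟩ := key _ hg
  have heq : f - g = (f - h) - (g - h) := by abel
  rw [heq]
  refine ⟨hfd.sub hgd, M + N, fun z hz hz1 => ?_⟩
  rw [Pi.sub_apply, add_mul]
  exact (norm_sub_le _ _).trans (add_le_add (hM z hz hz1) (hN z hz hz1))

end HoloVolterra

/-- Under the stated conditions on the kernels, for any `ρ > τ` the equation `f = V f` on `Ω` has at
most one solution in the affine space `f₀ + singExpAlg (ρ - 1) Ω`. -/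
theorem corollary4
    (Ω : Set ℂ) (hΩ : HoloVolterra.IsStarDomain Ω)
    (p q : ℂ → ℂ) (hp : DifferentiableOn ℂ p Ω) (hq : DifferentiableOn ℂ q Ω)
    (hp0 : ∀ a ∈ Ω, p a ≠ 0)
    (kstar : ℂ → ℂ → ℂ)
    (hkstar : DifferentiableOn ℂ (fun x : ℂ × ℂ => kstar x.1 x.2) (Ω ×ˢ Ω))
    (τ γ lam : ℝ)
    (hsing : HoloVolterra.RegularSingular Ω (HoloVolterra.sepKernel p q) τ)
    (hdiag : HoloVolterra.DiagBound Ω (HoloVolterra.sepKernel p q) lam)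
    (hstar : HoloVolterra.DiagVanishing Ω kstar γ lam)
    (b : ℂ) (hb : b ∈ Ω) (ρ : ℝ) (hρ : τ < ρ)
    (f g : ℂ → ℂ)
    (hf : f - HoloVolterra.protoSolution Ω p q b ∈ HoloVolterra.singExpAlg (ρ - 1) Ω)
    (hg : g - HoloVolterra.protoSolution Ω p q b ∈ HoloVolterra.singExpAlg (ρ - 1) Ω)
    (hfV : ∀ a ∈ Ω, f a = HoloVolterra.perturbedOp p q kstar f a)
    (hgV : ∀ a ∈ Ω, g a = HoloVolterra.perturbedOp p q kstar g a) :
    Set.EqOn f g Ω := by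
  obtain ⟨hd, M, hM⟩ := HoloVolterra.exists_bound_of_sub_mem_singExpAlg hf hg
  have hρ0 : 0 < ρ := hsing.pos.trans hρ
  -- The gap between `τ` and `ρ` is shared: `σ` bounds `k₀`, and `ε < ρ - σ` absorbs `k⋆`.
  obtain ⟨σ, hτσ, hσρ⟩ := exists_between hρ
  obtain ⟨ε, hε, hερ⟩ := exists_between (sub_pos.2 hσρ)
  have hσ0 : 0 < σ := hsing.pos.trans hτσ
  obtain ⟨δ₁, hδ₁, hk₁⟩ := hsing.exists_near hτσ
  obtain ⟨δ₂, hδ₂, hk₂⟩ := hstar.exists_near hε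
  have hδ : 0 < min 1 (min δ₁ δ₂) := lt_min one_pos (lt_min hδ₁ hδ₂)
  set δ := min 1 (min δ₁ δ₂)
  have hδ1 : δ ≤ 1 := min_le_left _ _
  have hδδ₁ : δ ≤ δ₁ := (min_le_right _ _).trans (min_le_left _ _)
  have hδδ₂ : δ ≤ δ₂ := (min_le_right _ _).trans (min_le_right _ _)
  set θ := (σ + ε) / ρ with hθ
  have hθ0 : 0 ≤ θ := by positivity
  have hθ1 : θ < 1 := (div_lt_one hρ0).2 (by linarith)
  have hbound : ∀ n : ℕ, ∀ a ∈ Ω, ‖a‖ < δ → ‖(f - g) a‖ ≤ θ ^ n * M * ‖a‖ ^ (ρ - 1) := by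
    intro n
    induction n with
    | zero =>
      intro a ha hn
      simpa using hM a ha (hn.trans_le hδ1)
    | succ n ih =>
      intro a ha hn
      -- The segment from `0` to `a` never leaves `Ω ∩ {|ζ| < δ}`, so the induction hypothesis holds
      -- all along it with the same `δ`.
      have hmem : ∀ t : ℝ, 0 < t → t ≤ 1 → (t : ℂ) * a ∈ Ω ∧ ‖(t : ℂ) * a‖ < δ := by
        refine fun t ht ht1 => ⟨hΩ.star a ha t ht ht1, lt_of_le_of_lt ?_ hn⟩
        rw [norm_mul, Complex.norm_real, Real.norm_of_nonneg ht.le]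
        exact mul_le_of_le_one_left (norm_nonneg a) ht1
      have hdb : ∀ t : ℝ, 0 < t → t ≤ 1 →
          ‖(f - g) (t * a)‖ ≤ θ ^ n * M * ‖(t : ℂ) * a‖ ^ (ρ - 1) :=
        fun t ht ht1 => ih _ (hmem t ht ht1).1 (hmem t ht ht1).2
      have hsep : ContinuousOn (HoloVolterra.sepKernel p q a) Ω :=
        (hq.continuousOn.div_const (p a)).neg
      have hper : ContinuousOn (kstar a) Ω :=
        hkstar.continuousOn.comp (f := fun x => (a, x)) (by fun_prop) fun x hx => ⟨ha, hx⟩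
      have h₁ := HoloVolterra.norm_volterraOp_sub_le hΩ ha hσ0.le hρ0 hsep hd.continuousOn
        (fun t ht ht1 => hk₁ a ha _ (hmem t ht ht1).1 (hn.trans_le hδδ₁)
          ((hmem t ht ht1).2.trans_le hδδ₁)) hdb
      have h₂ := HoloVolterra.norm_volterraOp_sub_le hΩ ha hε.le hρ0 hper hd.continuousOn
        (fun t ht ht1 => hk₂ a ha _ (hmem t ht ht1).1 (hn.trans_le hδδ₂)
          ((hmem t ht ht1).2.trans_le hδδ₂)) hdb
      rw [Pi.sub_apply, hfV a ha, hgV a ha, HoloVolterra.perturbedOp, HoloVolterra.perturbedOp,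
        add_sub_add_comm]
      refine (norm_add_le_of_le h₁ h₂).trans_eq ?_
      rw [pow_succ, hθ]
      ring
  have hzero : ∀ a ∈ Ω, ‖a‖ < δ → (f - g) a = 0 := by
    intro a ha hn
    have hlim : Tendsto (fun n : ℕ => θ ^ n * M * ‖a‖ ^ (ρ - 1)) atTop (𝓝 0) := by
      simpa using ((tendsto_pow_atTop_nhds_zero_of_lt_one hθ0 hθ1).mul_const M).mul_const
        (‖a‖ ^ (ρ - 1))
    exact norm_le_zero_iff.1 (ge_of_tendsto' hlim fun n => hbound n a ha hn)
  -- As `0 ∉ Ω`, the identity theorem is applied at a nearby point of `Ω`.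
  obtain ⟨c, hcΩ, hcδ⟩ := Metric.mem_closure_iff.1 hΩ.touches_zero δ hδ
  rw [dist_zero_left] at hcδ
  have hev : (f - g) =ᶠ[𝓝 c] 0 := by
    filter_upwards [hΩ.isOpen.mem_nhds hcΩ, (isOpen_lt continuous_norm continuous_const).mem_nhds
      hcδ] with a ha hn using hzero a ha hn
  have hconn : IsPreconnected Ω := hΩ.simplyConnected.isPathConnected.isConnected.isPreconnected
  exact fun a ha => sub_eq_zero.1
    ((hd.analyticOnNhd hΩ.isOpen).eqOn_zero_of_preconnected_of_eventuallyEq_zero hconn hcΩ hev ha)
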